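/- Let $\lambda>\aleph_1$ be a regular cardinal. *The class.* A ray is a one-way infinite path, its tails are its infinite connected subgraphs, and two rays are tail-equivalent if they share a common tail. For a graph $G$ and a vertex $v$ let $G[v]$ be the neighbourhood of $v$. Let $\mathcal G_\lambda$ be the class of graphs $G$ with $\lambda$ vertices such that for every $v\in G$ the subgraph induced on $G[v]$ has at most one ray up to tail-equivalence. If $H,G\in\mathcal G_\lambda$, then $H$ is an $r$-subgraph of $G$ if $H$ is a subgraph of $G$ and, for every vertex $v$ of $H$, if (the graph induced by $G$ on) $G[v]$ contains a ray then so does (the graph induced by $H$ on) $H[v]$. *The invariant.* Let $\bar C=\langle c_\delta:\delta\in S\rangle$ be a club guessing sequence on $\lambda$ of order type $\omega$: $S\subseteq\lambda$ is stationary, each $c_\delta=\{\alpha^\delta_0<\alpha^\delta_1<\dots\}$ has order type $\omega$ and supremum $\delta$, and for every club $E\subseteq\lambda$ the set $\{\delta\in S:c_\delta\subseteq E\}$ is stationary. Let $I$ be the ideal of all $X\subseteq\lambda$ for which there is a club $E$ such that for no $\delta\in X\cap S\cap E$ an end segment of $c_\delta$ is contained in $E$. For $G\in\mathcal G_\lambda$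 choose a bijection $h$ from the vertices of $G$ onto $\lambda$ and a function $r$ such that $r(v)$ is a ray in $G[v]$ if there is one and $r(v)=\emptyset$ otherwise; put $G^\alpha=\{v:h(v)<\alpha\}$ and, for $v\in G$ and $\delta\in S$, $$\varphi(v,\delta)=[\{n<\omega: r(v)\cap G^{\alpha^\delta_n}\subsetneq r(v)\cap G^{\alpha^\delta_{n+1}}\}]\in\mathcal P(\omega)/\mathrm{fin},\qquad \varphi(G,\delta)=\{\varphi(v,\delta):v\in G\}.$$ Let $\hat\Phi(G)$ be the set of all $x\in\mathcal P(\omega)/\mathrm{fin}$ with $\{\delta\in S:x\in\varphi(G,\delta)\}\notin I$, and let $\Phi(G)=\hat\Phi(G)\setminus\{[\emptyset]\}$. *Claim.* If $G\in\mathcal G_\lambda$ and $|\Phi(G)|=1$, then $G$ is $(r,\lambda)$-indecomposable: whenever $G$ is covered by a family $\langle G_i\rangle$ of fewer than $\lambda$ $r$-subgraphs (it is enough that their vertex sets cover that of $G$), there is an $i$ with $\Phi(G_i)=\Phi(G)$. The same holds with $\hat\Phi$ in place of $\Phi$ throughout. Both hold for every $\bar C$ as above and for every choice of the auxiliary $h,r$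 on $G$ and, independently, on each $G_i$. -/

import Mathlib

universe u

namespace RayGraph

open Set

/-! ### Rays and the class of graphs -/

/-- A ray (one-way infinite path) in a graph, enumerated from its first vertex. -/
structure Ray {V : Type u} (G : SimpleGraph V) where
  vert : ℕ → V
  injective : Function.Injective vert
  adj : ∀ n, G.Adj (vert n) (vert (n + 1))

/-- Two rays are tail-equivalent if they share a common tail. The tails of a ray (its infinite
connected subgraphs) are exactly what is left after deleting the first `k` vertices, for some `k`. -/
def Ray.TailEquiv {V : Type u} {G : SimpleGraph V} (R R' : Ray G) : Prop :=
  ∃ k l : ℕ, ∀ n, R.vert (n + k) = R'.vert (n + l)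

/-- The subgraph of `G` induced on the neighbourhood `G[v]` of `v`. -/
abbrev nbhd {V : Type u} (G : SimpleGraph V) (v : V) : SimpleGraph (G.neighborSet v) :=
  G.induce (G.neighborSet v)

/-- `G` belongs to `𝒢_lam`: it has `lam` vertices, and for every vertex `v` the graph induced on
the neighbourhood of `v` has at most one ray up to tail-equivalence. -/
structure InClass (lam : Cardinal.{u}) {V : Type u} (G : SimpleGraph V) : Prop where
  card_eq : Cardinal.mk V = lam
  tailEquiv : ∀ (v : V) (R R' : Ray (nbhd G v)), R.TailEquiv R'

/-- A subgraph `H` of `G` is an `r`-subgraph of `G` if both graphs are in `𝒢_lam` and, for every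
vertex `v` of `H`, the neighbourhood `H[v]` contains a ray whenever `G[v]` does. -/
structure IsRSubgraph (lam : Cardinal.{u}) {V : Type u} {G : SimpleGraph V} (H : G.Subgraph) :
    Prop where
  inClass : InClass lam G
  inClass_coe : InClass lam H.coe
  ray : ∀ v : H.verts, Nonempty (Ray (nbhd G (v : V))) → Nonempty (Ray (nbhd H.coe v))

/-! ### Subsets of `ω` modulo finite sets -/

/-- Equality of sets of natural numbers modulo finite sets. -/
def finSetoid : Setoid (Set ℕ) where
  r X Y := (symmDiff X Y).Finite
  iseqv :=
    { refl := fun X => by simp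
      symm := fun {X Y} h => by rwa [symmDiff_comm]
      trans := fun {X Y Z} h h' => (h.union h').subset (symmDiff_triangle X Y Z) }

/-- `𝒫(ω)/fin`. -/
def PModFin : Type := Quotient finSetoid

/-- The class of `X ⊆ ω` in `𝒫(ω)/fin`. -/
def PModFin.mk (X : Set ℕ) : PModFin := Quotient.mk finSetoid X

/-! ### Club guessing -/

/-- The set of ordinals below `lam`, as a well-ordered type. -/
abbrev Below (lam : Cardinal.{u}) : Type u := lam.ord.ToType

/-- A club guessing sequence `⟨c_δ : δ ∈ S⟩` on `lam` with every `c_δ` of order type `ω`; each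
`c_δ` is given by its increasing enumeration `n ↦ c δ n`. -/
structure ClubGuessing (lam : Cardinal.{u}) where
  S : Set (Below lam)
  stationary : IsStationary S
  c : Below lam → ℕ → Below lam
  strictMono : ∀ δ ∈ S, StrictMono (c δ)
  isLUB : ∀ δ ∈ S, IsLUB (range (c δ)) δ
  guess : ∀ E : Set (Below lam), IsClub E → IsStationary {δ | δ ∈ S ∧ range (c δ) ⊆ E}

/-- The guessing ideal `id^b`: `X` is in it iff there is a club `E` such that no `c_δ` with
`δ ∈ X ∩ S ∩ E` has an end segment contained in `E`. -/
def ClubGuessing.Null {lam : Cardinal.{u}} (C : ClubGuessing lam) (X : Set (Below lam)) : Prop :=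
  ∃ E : Set (Below lam), IsClub E ∧ ∀ δ ∈ X ∩ C.S ∩ E, ¬ ∃ k, ∀ n, k ≤ n → C.c δ n ∈ E

/-! ### The invariant of a graph -/

/-- The auxiliary parameters on a graph `G`: an enumeration `h` of the vertices in order type
`lam`, and a function `r` that assigns to `v` (the vertex set of) a ray in the neighbourhood of
`v`, or `∅` if there is none. -/
structure Param (lam : Cardinal.{u}) {V : Type u} (G : SimpleGraph V) where
  h : V ≃ Below lam
  r : V → Set V
  r_ray : ∀ v, Nonempty (Ray (nbhd G v)) →
    ∃ R : Ray (nbhd G v), r v = range fun n => ((R.vert n : G.neighborSet v) : V)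
  r_empty : ∀ v, IsEmpty (Ray (nbhd G v)) → r v = ∅

namespace Param

variable {lam : Cardinal.{u}} {V : Type u} {G : SimpleGraph V}

/-- `G^α`, the set of vertices enumerated before `α`. -/
def initial (p : Param lam G) (α : Below lam) : Set V := {v | p.h v < α}

/-- `φ(v, δ)`: the class modulo finite of the set of `n` such that `r(v)` has a vertex in
`G^{α_{n+1}}` outside `G^{α_n}`, where `⟨α_n⟩` enumerates `c_δ`. -/
def phiVert (p : Param lam G) (C : ClubGuessing lam) (v : V) (δ : Below lam) : PModFin :=
  PModFin.mk {n | p.r v ∩ p.initial (C.c δ n) ⊂ p.r v ∩ p.initial (C.c δ (n + 1))}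

/-- `φ(G, δ)`. -/
def phi (p : Param lam G) (C : ClubGuessing lam) (δ : Below lam) : Set PModFin :=
  range fun v => p.phiVert C v δ

/-- The elements of `𝒫(ω)/fin` that appear in `φ(G, δ)` for a positive set of `δ`, the class of
`∅` included. -/
def PhiFull (C : ClubGuessing lam) (p : Param lam G) : Set PModFin :=
  {x | ¬ C.Null {δ | δ ∈ C.S ∧ x ∈ p.phi C δ}}

/-- `Φ(G)`: the nonzero elements of `𝒫(ω)/fin` that appear in `φ(G, δ)` for a positive set of
`δ`. The class of `∅` is left out, since it appears for every graph: a fixed vertex `v` has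
`φ(v, δ) = [∅]` for all large `δ`. -/
def Phi (C : ClubGuessing lam) (p : Param lam G) : Set PModFin :=
  PhiFull C p \ {PModFin.mk ∅}

end Param

/-- `(r, lam)`-indecomposability of `G` with respect to an invariant `F`: whenever fewer than `lam`
many `r`-subgraphs of `G` cover `G`, one of them has the same invariant as `G`. The invariants are
computed from arbitrary auxiliary parameters, chosen independently on `G` and on the pieces. -/
def Indecomposable (lam : Cardinal.{u})
    (F : ∀ {W : Type u} {K : SimpleGraph W}, Param lam K → Set PModFin)
    {V : Type u} {G : SimpleGraph V} (p : Param lam G) : Prop :=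
  ∀ (ι : Type u) (H : ι → G.Subgraph), Cardinal.mk ι < lam →
    (∀ i, IsRSubgraph lam (H i)) → (⋃ i, (H i).verts) = univ →
    ∀ q : ∀ i, Param lam (H i).coe, ∃ i, F (q i) = F p

end RayGraph

namespace RayGraph

open Set

/-! ### Clubs below a regular cardinal -/

section Club

variable {lam : Cardinal.{u}}

/-! Up to finite sets, `r(v)` is determined by the graph: a ray in `H[v]` is also a ray in `G[v]`,
where all rays are tail-equivalent (`finite_symmDiff_r`). Enumerations of `G` and `H` have the same
initial segments on a club (`isClub_agree`), and once an end segment of `c_δ` lies in it, both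
graphs give `v` the same class (`phiVert_eq_of_agree`). Hence an `r`-subgraph has no new invariants.
Fewer than `lam` clubs meet in a club, so every invariant of `G` survives in some piece of the
cover. A one-element invariant is then attained by a single piece. -/

theorem cof_below (hreg : lam.IsRegular) : Order.cof (Below lam) = lam := by
  rw [Ordinal.cof_toType, hreg.cof_ord]

theorem exists_forall_lt_of_mk_lt (hreg : lam.IsRegular) {s : Set (Below lam)}
    (hs : Cardinal.mk s < lam) : ∃ a, ∀ b ∈ s, b < a := by
  rw [← not_isCofinal_iff]
  intro h
  exact ((Order.cof_le h).trans_lt hs).ne (cof_below hreg)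

/-- The closure points of a function form a club. -/
theorem isClub_closurePoints (hreg : lam.IsRegular) (hunc : Cardinal.aleph0 < lam)
    (f : Below lam → Below lam) : IsClub {a | ∀ b < a, f b < a} := by
  refine ⟨fun d hd _ _ a ha b hb => ?_, fun a => ?_⟩
  · obtain ⟨c, hc, hbc⟩ := (lt_isLUB_iff ha).1 hb
    exact (hd hc b hbc).trans_le (ha.1 hc)
  -- Start at `a`, repeatedly bound the `f`-image of the initial segment reached, and take the
  -- supremum `m` of these `ω` steps; it exists because the cofinality is uncountable.
  · have hbound (a : Below lam) : ∃ b, ∀ x ∈ f '' Iio a, x < b :=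
      exists_forall_lt_of_mk_lt hreg
        (Cardinal.mk_image_le.trans_lt (by simpa using Cardinal.mk_Iio_lt a (by simp)))
    choose g hg using hbound
    let s : ℕ → Below lam := Nat.rec a fun _ x => g x
    obtain ⟨u, hu⟩ : ∃ u, ∀ x ∈ range s, x < u :=
      exists_forall_lt_of_mk_lt hreg ((Cardinal.le_aleph0_iff_set_countable.2 (countable_range s)).trans_lt hunc)
    have hne : (upperBounds (range s)).Nonempty := ⟨u, fun x hx => (hu x hx).le⟩
    let m := wellFounded_lt.min (upperBounds (range s)) hne
    have hm : m ∈ upperBounds (range s) := wellFounded_lt.min_mem _ hne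
    refine ⟨m, fun b hb => ?_, hm ⟨0, rfl⟩⟩
    have hnot : b ∉ upperBounds (range s) := fun h =>
      wellFounded_lt.not_lt_min (upperBounds (range s)) h hb
    simp only [mem_upperBounds, mem_range, forall_exists_index, forall_apply_eq_imp_iff,
      not_forall, not_le] at hnot
    obtain ⟨n, hn⟩ := hnot
    exact (hg (s n) _ ⟨b, hn, rfl⟩).trans_le (hm ⟨n + 1, rfl⟩)

theorem isClub_iInter_below (hreg : lam.IsRegular) (hunc : Cardinal.aleph0 < lam) {ι : Type u}
    (hι : Cardinal.mk ι < lam) {E : ι → Set (Below lam)} (hE : ∀ i, IsClub (E i)) :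
    IsClub (⋂ i, E i) :=
  IsClub.iInter (by rw [cof_below hreg]; exact hunc.ne') (by simpa [cof_below hreg] using hι) hE

theorem isClub_inter_below (hreg : lam.IsRegular) (hunc : Cardinal.aleph0 < lam)
    {E F : Set (Below lam)} (hE : IsClub E) (hF : IsClub F) : IsClub (E ∩ F) :=
  hE.inter (by rw [cof_below hreg]; exact hunc.ne') hF

end Club

/-! ### Rays in subgraphs -/

section Rays

variable {V : Type u} {G : SimpleGraph V}

theorem Ray.TailEquiv.finite_symmDiff {R R' : Ray G} (h : R.TailEquiv R') :
    (symmDiff (range R.vert) (range R'.vert)).Finite := by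
  obtain ⟨k, l, hkl⟩ := h
  refine (((finite_Iio k).image R.vert).union ((finite_Iio l).image R'.vert)).subset ?_
  rintro x (⟨⟨n, rfl⟩, hn⟩ | ⟨⟨n, rfl⟩, hn⟩)
  · refine .inl ⟨n, mem_Iio.2 <| lt_of_not_ge fun hkn => hn ⟨n - k + l, ?_⟩, rfl⟩
    rw [← hkl, Nat.sub_add_cancel hkn]
  · refine .inr ⟨n, mem_Iio.2 <| lt_of_not_ge fun hln => hn ⟨n - l + k, ?_⟩, rfl⟩
    rw [hkl, Nat.sub_add_cancel hln]

/-- A ray in a neighbourhood of a subgraph, seen in the neighbourhood of the whole graph. -/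
def Ray.ofSubgraph {H : G.Subgraph} {v : H.verts} (R : Ray (nbhd H.coe v)) :
    Ray (nbhd G (v : V)) where
  vert n := ⟨((R.vert n : H.coe.neighborSet v) : H.verts), H.adj_sub (R.vert n).2⟩
  injective _ _ h := R.injective (Subtype.ext (Subtype.ext (Subtype.mk.inj h)))
  adj n := H.adj_sub (R.adj n)

theorem finite_symmDiff_r {lam : Cardinal.{u}} {H : G.Subgraph} (hH : IsRSubgraph lam H)
    (p : Param lam G) (q : Param lam H.coe) (v : H.verts) :
    (symmDiff (p.r v) (Subtype.val '' q.r v)).Finite := by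
  rcases isEmpty_or_nonempty (Ray (nbhd G (v : V))) with hG | hG
  · have hH' : IsEmpty (Ray (nbhd H.coe v)) := ⟨fun R => hG.false R.ofSubgraph⟩
    simp [p.r_empty v hG, q.r_empty v hH']
  · obtain ⟨R, hR⟩ := p.r_ray v hG
    obtain ⟨R', hR'⟩ := q.r_ray v (hH.ray v hG)
    have h := (hH.inClass.tailEquiv v R R'.ofSubgraph).finite_symmDiff.image Subtype.val
    rw [image_symmDiff Subtype.val_injective, ← range_comp, ← range_comp] at h
    rw [hR, hR', ← range_comp]
    exact h

end Rays

/-! ### Comparing the invariant of a graph with that of an `r`-subgraph -/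

namespace Param

variable {lam : Cardinal.{u}} {V : Type u} {G : SimpleGraph V}

theorem inter_initial_ssubset_iff (p : Param lam G) (A : Set V) {a b : Below lam} (hab : a ≤ b) :
    A ∩ p.initial a ⊂ A ∩ p.initial b ↔ ∃ x ∈ A, a ≤ p.h x ∧ p.h x < b := by
  have hsub : A ∩ p.initial a ⊆ A ∩ p.initial b :=
    inter_subset_inter_right _ fun x (hx : p.h x < a) => hx.trans_le hab
  rw [ssubset_iff_exists, and_iff_right hsub]
  simp only [mem_inter_iff, initial, mem_ofPred_eq]
  constructor
  · rintro ⟨x, ⟨hxA, hxb⟩, hxa⟩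
    exact ⟨x, hxA, not_lt.1 fun h => hxa ⟨hxA, h⟩, hxb⟩
  · rintro ⟨x, hxA, hax, hxb⟩
    exact ⟨x, ⟨hxA, hxb⟩, fun h => hax.not_gt h.2⟩

/-- The points at which the enumerations of a graph and of a subgraph agree. -/
def agree {H : G.Subgraph} (p : Param lam G) (q : Param lam H.coe) : Set (Below lam) :=
  {a | ∀ v : H.verts, p.h v < a ↔ q.h v < a}

/-- Unboundedness: a point closed under both translations between the two enumerations cuts off the
same vertices of `H` in each. -/
theorem isClub_agree (hreg : lam.IsRegular) (hunc : Cardinal.aleph0 < lam) {H : G.Subgraph}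
    (p : Param lam G) (q : Param lam H.coe) : IsClub (p.agree q) := by
  classical
  let f : Below lam → Below lam := fun b =>
    if hb : p.h.symm b ∈ H.verts then q.h ⟨p.h.symm b, hb⟩ else b
  have hf (v : H.verts) : f (p.h v) = q.h v := by simp [f]
  refine ⟨fun d hd _ _ a ha v => ?_, fun a => ?_⟩
  · rw [lt_isLUB_iff ha, lt_isLUB_iff ha]
    exact exists_congr fun c => and_congr_right fun hc => hd hc v
  · obtain ⟨b, ⟨hb, hb'⟩, hab⟩ := (isClub_inter_below hreg hunc
      (isClub_closurePoints hreg hunc f)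
      (isClub_closurePoints hreg hunc fun b => p.h (q.h.symm b))).isCofinal a
    refine ⟨b, fun v => ⟨fun h => ?_, fun h => ?_⟩, hab⟩
    · simpa [hf] using hb _ h
    · simpa using hb' _ h

/-- From `k` on, a disagreement at `n` needs a vertex in just one of the two rays, enumerated in
`[α_n, α_{n+1})`. There are finitely many such vertices, and the intervals are disjoint. -/
theorem phiVert_eq_of_agree {H : G.Subgraph} (hH : IsRSubgraph lam H) (C : ClubGuessing lam)
    (p : Param lam G) (q : Param lam H.coe) {δ : Below lam} (hδ : δ ∈ C.S) {k : ℕ}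
    (hk : ∀ n, k ≤ n → C.c δ n ∈ p.agree q) (v : H.verts) :
    q.phiVert C v δ = p.phiVert C v δ := by
  have hmono := (C.strictMono δ hδ).monotone
  refine Quotient.sound ?_
  have hfin : (⋃ x ∈ symmDiff (p.r v) (Subtype.val '' q.r v),
      {n | C.c δ n ≤ p.h x ∧ p.h x < C.c δ (n + 1)}).Finite := by
    refine (finite_symmDiff_r hH p q v).biUnion fun x _ => Set.Subsingleton.finite ?_
    rintro m ⟨hm, hm'⟩ n ⟨hn, hn'⟩
    have h1 := hmono.reflect_lt (hm.trans_lt hn')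
    have h2 := hmono.reflect_lt (hn.trans_lt hm')
    omega
  refine ((finite_Iio k).union hfin).subset fun n hn => ?_
  by_cases hkn : n < k
  · exact .inl hkn
  -- Both endpoints of the interval are in `p.agree q`, since `n` and `n + 1` are at least `k`.
  have hag (w : H.verts) : (C.c δ n ≤ q.h w ∧ q.h w < C.c δ (n + 1)) ↔
      (C.c δ n ≤ p.h w ∧ p.h w < C.c δ (n + 1)) := by
    rw [← not_lt, ← not_lt, hk n (by omega) w, hk (n + 1) (by omega) w]
  rw [mem_symmDiff, mem_ofPred_eq, mem_ofPred_eq,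
    inter_initial_ssubset_iff _ _ (hmono n.le_succ),
    inter_initial_ssubset_iff _ _ (hmono n.le_succ)] at hn
  right
  rw [mem_iUnion₂]
  rcases hn with ⟨⟨w, hw, hwn⟩, hno⟩ | ⟨⟨x, hx, hxn⟩, hno⟩
  · rw [hag] at hwn
    exact ⟨w, .inr ⟨⟨w, hw, rfl⟩, fun h => hno ⟨w, h, hwn⟩⟩, hwn⟩
  · refine ⟨x, .inl ⟨hx, ?_⟩, hxn⟩
    rintro ⟨w, hw, rfl⟩
    exact hno ⟨w, hw, (hag w).2 hxn⟩

theorem phiFull_subset_of_isRSubgraph (hreg : lam.IsRegular) (hunc : Cardinal.aleph0 < lam)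
    {H : G.Subgraph} (hH : IsRSubgraph lam H) (C : ClubGuessing lam) (p : Param lam G)
    (q : Param lam H.coe) : PhiFull C q ⊆ PhiFull C p := by
  rintro x hx ⟨E, hE, hEx⟩
  refine hx ⟨E ∩ p.agree q, isClub_inter_below hreg hunc hE (isClub_agree hreg hunc p q), ?_⟩
  rintro δ ⟨⟨⟨hδ, v, hv⟩, -⟩, hδE, -⟩ ⟨k, hk⟩
  refine hEx δ ⟨⟨⟨hδ, v, ?_⟩, hδ⟩, hδE⟩ ⟨k, fun n hn => (hk n hn).1⟩
  rw [← hv]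
  exact (phiVert_eq_of_agree hH C p q hδ (fun n hn => (hk n hn).2) v).symm

/-- This is `lam`-completeness of the guessing ideal: were `x` null for every piece, the
intersection of the witnessing clubs and the agreement clubs would make it null for `G`. The piece
containing `v` may vary with `δ`. -/
theorem phiFull_subset_iUnion (hreg : lam.IsRegular) (hunc : Cardinal.aleph0 < lam)
    {ι : Type u} (hι : Cardinal.mk ι < lam) {H : ι → G.Subgraph}
    (hH : ∀ i, IsRSubgraph lam (H i)) (hcov : (⋃ i, (H i).verts) = univ) (C : ClubGuessing lam)
    (p : Param lam G) (q : ∀ i, Param lam (H i).coe) :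
    PhiFull C p ⊆ ⋃ i, PhiFull C (q i) := by
  intro x hx
  by_contra hno
  simp only [mem_iUnion, not_exists, PhiFull, mem_ofPred_eq, not_not] at hno
  choose E hE hEx using hno
  refine hx ⟨⋂ i, E i ∩ p.agree (q i), isClub_iInter_below hreg hunc hι fun i =>
    isClub_inter_below hreg hunc (hE i) (isClub_agree hreg hunc p (q i)), ?_⟩
  rintro δ ⟨⟨⟨hδ, v, hv⟩, -⟩, hδE⟩ ⟨k, hk⟩
  obtain ⟨i, hi⟩ := mem_iUnion.1 (hcov.symm ▸ mem_univ v : v ∈ ⋃ i, (H i).verts)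
  have hki (n : ℕ) (hn : k ≤ n) := mem_iInter.1 (hk n hn) i
  refine hEx i δ ⟨⟨⟨hδ, ⟨v, hi⟩, ?_⟩, hδ⟩, (mem_iInter.1 hδE i).1⟩
    ⟨k, fun n hn => (hki n hn).1⟩
  rw [← hv]
  exact phiVert_eq_of_agree (hH i) C p (q i) hδ (fun n hn => (hki n hn).2) ⟨v, hi⟩

end Param

theorem exists_eq_of_encard_eq_one {α ι : Type*} {A : Set α} {B : ι → Set α}
    (hA : A.encard = 1) (hsub : ∀ i, B i ⊆ A) (hcov : A ⊆ ⋃ i, B i) : ∃ i, B i = A := by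
  obtain ⟨x, rfl⟩ := encard_eq_one.1 hA
  obtain ⟨i, hi⟩ := mem_iUnion.1 (hcov rfl)
  exact ⟨i, (hsub i).antisymm (singleton_subset_iff.2 hi)⟩

end RayGraph

theorem claim4p2 (lam : Cardinal.{u}) (hreg : lam.IsRegular) (hlam : Cardinal.aleph 1 < lam)
    (C : RayGraph.ClubGuessing lam) {V : Type u} (G : SimpleGraph V)
    (hG : RayGraph.InClass lam G) (p : RayGraph.Param lam G) :
    ((RayGraph.Param.Phi C p).encard = 1 →
      RayGraph.Indecomposable lam (fun q => RayGraph.Param.Phi C q) p) ∧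
    ((RayGraph.Param.PhiFull C p).encard = 1 →
      RayGraph.Indecomposable lam (fun q => RayGraph.Param.PhiFull C q) p) := by
  have hunc : Cardinal.aleph0 < lam := (Cardinal.aleph0_lt_aleph_one).trans hlam
  refine ⟨fun h ι H hι hH hcov q => ?_, fun h ι H hι hH hcov q => ?_⟩
  · refine RayGraph.exists_eq_of_encard_eq_one h (fun i => Set.sdiff_subset_sdiff_left
      (RayGraph.Param.phiFull_subset_of_isRSubgraph hreg hunc (hH i) C p (q i))) ?_
    simp only [RayGraph.Param.Phi]
    -- Discarding the class of `∅` commutes with unions, so the covering for `PhiFull` passes to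
    -- `Phi`.
    rw [← Set.iUnion_sdiff]
    exact Set.sdiff_subset_sdiff_left
      (RayGraph.Param.phiFull_subset_iUnion hreg hunc hι hH hcov C p q)
  · exact RayGraph.exists_eq_of_encard_eq_one h
      (fun i => RayGraph.Param.phiFull_subset_of_isRSubgraph hreg hunc (hH i) C p (q i))
      (RayGraph.Param.phiFull_subset_iUnion hreg hunc hι hH hcov C p q)
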